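/- Let $\mathbb T=\mathbb R/\mathbb Z$, let $\mathbb T^{\mathbb N}$ be the infinite-dimensional torus with the product topology, and let $\mathrm{Aut}(\mathbb T^{\mathbb N})$ be the group of its automorphisms that are homeomorphisms. Let $G$ be a countable (discrete) group. Equip the abelian group $\mathrm{Hom}(G,\mathbb T^{\mathbb N})$ of all homomorphisms (under pointwise addition) with the topology of pointwise convergence; it is then a compact group. The group $\mathrm{Aut}(\mathbb T^{\mathbb N})$ acts on it by $(\psi_*h)(g)=\psi(h(g))$. Let $\chi$ be a Borel probability measure on $\mathrm{Hom}(G,\mathbb T^{\mathbb N})$ that is invariant under this action and indecomposable, i.e. $\chi$ cannot be written as $\chi=t\chi_1+(1-t)\chi_2$ with $t\in(0,1)$ and $\chi_1\neq\chi_2$ two $\mathrm{Aut}(\mathbb T^{\mathbb N})$-invariant Borel probability measures on $\mathrm{Hom}(G,\mathbb T^{\mathbb N})$. Then there exists a normal subgroup $H\le G$ such that $\chi$ is the normalized (total mass one) Haar measure of the compact group $\mathrm{Hom}(G/H,\mathbb T^{\mathbb N})$, regarded as a measure on $\mathrm{Hom}(G,\mathbb T^{\mathbb N})$ through the natural embedding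 $\varphi\mapsto\varphi\circ\pi$, where $\pi:G\to G/H$ is the quotient map (the image of this embedding consists of the homomorphisms that vanish on $H$). When $G$ is abelian, every subgroup is normal, so $H$ is then simply a subgroup of $G$. -/

import Mathlib

open MeasureTheory

/-- The infinite-dimensional torus `𝕋^ℕ`, where `𝕋 = ℝ/ℤ`, with the product topology. -/
abbrev InfTorus : Type := ℕ → UnitAddCircle

/-- The Borel σ-algebra of the compact-open topology on the group `Hom(G, K)` of continuous
homomorphisms. For discrete `G` these are all the homomorphisms, and the compact-open topology is
the topology of pointwise convergence. -/
instance homBorelMeasurableSpace (G K : Type*) [AddMonoid G] [AddMonoid K] [TopologicalSpace G]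
    [TopologicalSpace K] : MeasurableSpace (G →ₜ+ K) :=
  borel _

instance homBorelSpace (G K : Type*) [AddMonoid G] [AddMonoid K] [TopologicalSpace G]
    [TopologicalSpace K] : BorelSpace (G →ₜ+ K) :=
  ⟨rfl⟩

/-- The action of `ψ ∈ Aut(K)` (automorphisms that are homeomorphisms) on `Hom(G, K)`:
`(ψ_* h)(g) = ψ (h g)`. -/
def autAct {G K : Type*} [AddGroup G] [TopologicalSpace G] [AddCommGroup K] [TopologicalSpace K]
    (ψ : K ≃ₜ+ K) (h : G →ₜ+ K) : G →ₜ+ K :=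
  (ψ : K →ₜ+ K).comp h

/-- `χ` is a Borel probability measure on `Hom(G, K)` that is invariant under `Aut(K)`. -/
structure IsAutInvariantProb {G K : Type*} [AddGroup G] [TopologicalSpace G] [AddCommGroup K]
    [TopologicalSpace K] (χ : Measure (G →ₜ+ K)) : Prop where
  isProbabilityMeasure : IsProbabilityMeasure χ
  map_eq : ∀ ψ : K ≃ₜ+ K, χ.map (autAct ψ) = χ

/-- `χ` is not of the form `t χ₁ + (1 - t) χ₂` with `t ∈ (0,1)` and `χ₁ ≠ χ₂` two
`Aut(K)`-invariant Borel probability measures on `Hom(G, K)`. -/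
def IsIndecomposable {G K : Type*} [AddGroup G] [TopologicalSpace G] [AddCommGroup K]
    [TopologicalSpace K] (χ : Measure (G →ₜ+ K)) : Prop :=
  ¬ ∃ (t : ℝ) (χ₁ χ₂ : Measure (G →ₜ+ K)), 0 < t ∧ t < 1 ∧
    IsAutInvariantProb χ₁ ∧ IsAutInvariantProb χ₂ ∧ χ₁ ≠ χ₂ ∧
    χ = ENNReal.ofReal t • χ₁ + ENNReal.ofReal (1 - t) • χ₂

/-- The continuous quotient homomorphism `G → G ⧸ H`. -/
def quotientHom {G : Type*} [AddGroup G] [TopologicalSpace G] (H : AddSubgroup G) [H.Normal] :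
    G →ₜ+ (G ⧸ H) where
  toAddMonoidHom := QuotientAddGroup.mk' H
  continuous_toFun := continuous_quotient_mk'

/-- The natural embedding `Hom(G ⧸ H, K) → Hom(G, K)`, `φ ↦ φ ∘ (G → G ⧸ H)`. Its image consists
of the homomorphisms that vanish on `H`. -/
def homQuotientEmbedding {G : Type*} (K : Type*) [AddGroup G] [TopologicalSpace G]
    [AddCommGroup K] [TopologicalSpace K] (H : AddSubgroup G) [H.Normal]
    (φ : (G ⧸ H) →ₜ+ K) : G →ₜ+ K :=
  φ.comp (quotientHom H)

instance quotientDiscreteTopology {G : Type*} [AddGroup G] [TopologicalSpace G]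
    [DiscreteTopology G] (H : AddSubgroup G) : DiscreteTopology (G ⧸ H) :=
  discreteTopology_iff_forall_isOpen.mpr fun s =>
    isOpen_coinduced.mpr (isOpen_discrete (QuotientAddGroup.mk ⁻¹' s))

/-- The normalized Haar measure (total mass one) on the compact group `Hom(G ⧸ H, K)`, regarded as
a measure on `Hom(G, K)` through the natural embedding. Here `G` is discrete and `K` is compact. -/
noncomputable def homQuotientHaar {G : Type*} (K : Type*) [AddGroup G] [TopologicalSpace G]
    [DiscreteTopology G] [AddCommGroup K] [TopologicalSpace K] [IsTopologicalAddGroup K]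
    [T2Space K] [CompactSpace K] (H : AddSubgroup G) [H.Normal] : Measure (G →ₜ+ K) :=
  (Measure.addHaarMeasure (⊤ : TopologicalSpace.PositiveCompacts ((G ⧸ H) →ₜ+ K))).map
    (homQuotientEmbedding K H)

/-! Fourier analysis on `Hom(G, 𝕋^ℕ)`: a finite measure is determined by its integrals against the
characters `circleChar g` (`hom_measure_ext`).

Indecomposability acts as ergodicity does in de Finetti's theorem. Conditioning on an event of the
odd coordinates leaves the law of the even ones invariant, so these conditional laws decompose `χ`
unless they coincide. Hence the two halves are independent copies of `χ`
(`indepFun_evenPart_oddPart`). The shear adding the odd half to the even one preserves `χ`, so `χ`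
is its own convolution square and every Fourier coefficient is 0 or 1
(`integral_circleChar_mul_self`).

Coefficient 1 makes the character trivial almost everywhere, and transvections then show that almost
every homomorphism kills each `g i` (`ae_apply_eq_zero`). With `H = aeKernel χ`, the coefficient at
`g` is therefore 1 if all `g i` lie in `H` and 0 otherwise, and Haar measure on `Hom(G/H, 𝕋^ℕ)` has
the same coefficients. -/

open scoped BoundedContinuousFunction

/-! ### Automorphisms of the torus. -/

section Automorphisms

/-- The endomorphism `x ↦ x ∘ ι` of the infinite-dimensional torus. -/
def reindexHom (ι : ℕ → ℕ) : InfTorus →ₜ+ InfTorus where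
  toFun x := x ∘ ι
  map_zero' := rfl
  map_add' _ _ := rfl
  continuous_toFun := by fun_prop

@[simp] lemma reindexHom_apply (ι : ℕ → ℕ) (x : InfTorus) (n : ℕ) :
    reindexHom ι x n = x (ι n) := rfl

/-- The automorphism `x ↦ x ∘ σ` of the infinite-dimensional torus. -/
def permAut (σ : Equiv.Perm ℕ) : InfTorus ≃ₜ+ InfTorus where
  toFun x := x ∘ σ
  invFun x := x ∘ σ.symm
  left_inv x := by ext; simp
  right_inv x := by ext; simp
  map_add' _ _ := rfl
  continuous_toFun := by fun_prop
  continuous_invFun := by fun_prop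

lemma continuous_single_apply (i j : ℕ) :
    Continuous fun x : InfTorus => (Pi.single i (x j) : InfTorus) :=
  (continuous_single (A := fun _ : ℕ => UnitAddCircle) i).comp (continuous_apply j)

/-- The automorphism of the infinite-dimensional torus adding the `j`-th coordinate to the
`i`-th one. -/
def transvectionAut {i j : ℕ} (hij : i ≠ j) : InfTorus ≃ₜ+ InfTorus where
  toFun x := x + Pi.single i (x j)
  invFun x := x - Pi.single i (x j)
  left_inv x := by simp [hij.symm]
  right_inv x := by simp [hij.symm]
  map_add' x y := by simp only [Pi.add_apply, Pi.single_add]; abel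
  continuous_toFun := continuous_id.add (continuous_single_apply i j)
  continuous_invFun := continuous_id.sub (continuous_single_apply i j)

/-- The even coordinates of a point of the infinite-dimensional torus. -/
def evenPart : InfTorus →ₜ+ InfTorus := reindexHom (2 * ·)

/-- The odd coordinates of a point of the infinite-dimensional torus. -/
def oddPart : InfTorus →ₜ+ InfTorus := reindexHom (2 * · + 1)

/-- The point with prescribed even and odd coordinates. -/
def interleave (a b : InfTorus) : InfTorus := fun n => if Even n then a (n / 2) else b (n / 2)

@[simp] lemma evenPart_interleave (a b : InfTorus) : evenPart (interleave a b) = a := by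
  ext n
  simp [evenPart, interleave]

@[simp] lemma oddPart_interleave (a b : InfTorus) : oddPart (interleave a b) = b := by
  ext n
  have : (2 * n + 1) / 2 = n := by omega
  simp [oddPart, interleave, this]

@[simp] lemma interleave_evenPart_oddPart (x : InfTorus) :
    interleave (evenPart x) (oddPart x) = x := by
  ext n
  rcases Nat.even_or_odd' n with ⟨k, rfl | rfl⟩
  · simp [evenPart, interleave]
  · have : (2 * k + 1) / 2 = k := by omega
    simp [oddPart, interleave, this]

lemma interleave_add (a b a' b' : InfTorus) :
    interleave (a + a') (b + b') = interleave a b + interleave a' b' := by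
  ext n
  by_cases h : Even n <;> simp [interleave, h]

lemma Continuous.interleave {X : Type*} [TopologicalSpace X] {f g : X → InfTorus}
    (hf : Continuous f) (hg : Continuous g) : Continuous fun x => interleave (f x) (g x) := by
  refine continuous_pi fun n => ?_
  by_cases h : Even n
  · simp only [_root_.interleave, h, if_true]
    exact (continuous_apply (n / 2)).comp hf
  · simp only [_root_.interleave, h, if_false]
    exact (continuous_apply (n / 2)).comp hg

/-- The automorphism acting by `ψ` on the even coordinates and fixing the odd ones. -/
def evenAut (ψ : InfTorus ≃ₜ+ InfTorus) : InfTorus ≃ₜ+ InfTorus where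
  toFun x := interleave (ψ (evenPart x)) (oddPart x)
  invFun x := interleave (ψ.symm (evenPart x)) (oddPart x)
  left_inv x := by simp
  right_inv x := by simp
  map_add' x y := by simp [interleave_add]
  continuous_toFun :=
    (ψ.continuous_toFun.comp evenPart.continuous_toFun).interleave oddPart.continuous_toFun
  continuous_invFun :=
    (ψ.continuous_invFun.comp evenPart.continuous_toFun).interleave oddPart.continuous_toFun

/-- The automorphism adding the odd coordinates to the even ones. -/
def shearAut : InfTorus ≃ₜ+ InfTorus where
  toFun x := interleave (evenPart x + oddPart x) (oddPart x)
  invFun x := interleave (evenPart x - oddPart x) (oddPart x)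
  left_inv x := by simp
  right_inv x := by simp
  map_add' x y := by
    rw [← interleave_add, map_add, map_add]
    congr 1
    abel
  continuous_toFun := (evenPart.continuous_toFun.add oddPart.continuous_toFun).interleave
    oddPart.continuous_toFun
  continuous_invFun := (evenPart.continuous_toFun.sub oddPart.continuous_toFun).interleave
    oddPart.continuous_toFun

/-- Lets an automorphism stand in for an injective reindexing whenever only finitely many
coordinates matter. -/
lemma exists_perm_eqOn_finset {α : Type*} {f : α → α} (hf : f.Injective) (s : Finset α) :
    ∃ σ : Equiv.Perm α, ∀ i ∈ s, σ i = f i := by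
  classical
  let e : {x // x ∈ s} ≃ {x // x ∈ f '' (s : Set α)} := Equiv.Set.image f (s : Set α) hf
  exact ⟨e.extendSubtype, fun i hi => e.extendSubtype_apply_of_mem i hi⟩

end Automorphisms

/-! ### Characters of `Hom(G, 𝕋^ℕ)` and uniqueness of Fourier coefficients. -/

section Characters

variable {G : Type*} [AddGroup G] [TopologicalSpace G]

lemma continuous_hom_comp_left {K L : Type*} [AddCommGroup K] [TopologicalSpace K]
    [AddCommGroup L] [TopologicalSpace L] (f : K →ₜ+ L) :
    Continuous fun h : G →ₜ+ K => f.comp h :=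
  ContinuousAddMonoidHom.continuous_comp_right f

lemma continuous_autAct {K : Type*} [AddCommGroup K] [TopologicalSpace K] (ψ : K ≃ₜ+ K) :
    Continuous (autAct (G := G) ψ) :=
  continuous_hom_comp_left _

lemma continuous_homQuotientEmbedding (K : Type*) [AddCommGroup K] [TopologicalSpace K]
    (H : AddSubgroup G) [H.Normal] : Continuous (homQuotientEmbedding K H) :=
  ContinuousAddMonoidHom.continuous_comp_left _

/-- On a Polish space a point-separating star subalgebra of bounded continuous functions determines
finite measures. -/
instance homPolishSpace [DiscreteTopology G] [Countable G] : PolishSpace (G →ₜ+ InfTorus) := by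
  have : SecondCountableTopology (G →ₜ+ InfTorus) :=
    (ContinuousAddMonoidHom.isInducing_toContinuousMap G InfTorus).secondCountableTopology
  have : TopologicalSpace.MetrizableSpace (G →ₜ+ InfTorus) :=
    TopologicalSpace.metrizableSpace_of_t3_secondCountable _
  let := TopologicalSpace.metrizableSpaceMetric (G →ₜ+ InfTorus)
  infer_instance

/-- The circle-valued character `h ↦ ∑ i, h (g i) i` of `Hom(G, 𝕋^ℕ)`. -/
noncomputable def circleChar (g : ℕ →₀ G) (h : G →ₜ+ InfTorus) : Circle :=
  g.prod fun i a => AddCircle.toCircle (h a i)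

lemma circleChar_add_left (g g' : ℕ →₀ G) (h : G →ₜ+ InfTorus) :
    circleChar (g + g') h = circleChar g h * circleChar g' h := by
  classical
  refine Finsupp.prod_add_index (by simp) fun i _ a b => ?_
  rw [map_add, Pi.add_apply, AddCircle.toCircle_add]

@[simp] lemma circleChar_zero_left (h : G →ₜ+ InfTorus) : circleChar 0 h = 1 :=
  Finsupp.prod_zero_index

lemma circleChar_neg_left (g : ℕ →₀ G) (h : G →ₜ+ InfTorus) :
    circleChar (-g) h = (circleChar g h)⁻¹ := by
  rw [eq_inv_iff_mul_eq_one, ← circleChar_add_left, neg_add_cancel, circleChar_zero_left]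

lemma circleChar_add_right [DiscreteTopology G] (g : ℕ →₀ G) (h h' : G →ₜ+ InfTorus) :
    circleChar g (h + h') = circleChar g h * circleChar g h' := by
  simp only [circleChar, Finsupp.prod, ← Finset.prod_mul_distrib]
  exact Finset.prod_congr rfl fun i _ => AddCircle.toCircle_add _ _

@[simp] lemma circleChar_single (i : ℕ) (a : G) (h : G →ₜ+ InfTorus) :
    circleChar (Finsupp.single i a) h = AddCircle.toCircle (h a i) :=
  Finsupp.prod_single_index (by simp)

lemma continuous_circleChar (g : ℕ →₀ G) : Continuous (circleChar g) := by
  refine continuous_finsetProd _ fun i _ => AddCircle.continuous_toCircle.comp ?_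
  exact (continuous_apply i).comp (ContinuousEvalConst.continuous_eval_const (g i))

lemma toCircle_eq_one_iff (x : UnitAddCircle) : AddCircle.toCircle x = 1 ↔ x = 0 := by
  rw [← AddCircle.toCircle_zero, (AddCircle.injective_toCircle one_ne_zero).eq_iff]

variable [DiscreteTopology G]

/-- The characters of `Hom(G, 𝕋^ℕ)` as bounded continuous functions. -/
noncomputable def homChar (g : ℕ →₀ G) : (G →ₜ+ InfTorus) →ᵇ ℂ :=
  BoundedContinuousFunction.mkOfCompact
    ⟨fun h => (circleChar g h : ℂ), continuous_subtype_val.comp (continuous_circleChar g)⟩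

lemma homChar_apply (g : ℕ →₀ G) (h : G →ₜ+ InfTorus) : homChar g h = (circleChar g h : ℂ) := rfl

variable (G) in
/-- The submonoid of characters of `Hom(G, 𝕋^ℕ)`. -/
noncomputable def homCharSubmonoid : Submonoid ((G →ₜ+ InfTorus) →ᵇ ℂ) where
  carrier := Set.range homChar
  one_mem' := ⟨0, by ext; simp [homChar_apply]⟩
  mul_mem' := by
    rintro _ _ ⟨g, rfl⟩ ⟨g', rfl⟩
    exact ⟨g + g', by ext; simp [homChar_apply, circleChar_add_left]⟩

variable (G) in
/-- The star subalgebra spanned by the characters of `Hom(G, 𝕋^ℕ)`. -/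
noncomputable def homCharAlgebra : StarSubalgebra ℂ ((G →ₜ+ InfTorus) →ᵇ ℂ) where
  toSubalgebra := Algebra.adjoin ℂ (homCharSubmonoid G)
  star_mem' {f} hf := by
    induction hf using Algebra.adjoin_induction with
    | mem x hx =>
      obtain ⟨g, rfl⟩ := hx
      refine Algebra.subset_adjoin ⟨-g, ?_⟩
      ext h
      simp only [homChar_apply, circleChar_neg_left, Circle.coe_inv_eq_conj, BoundedContinuousFunction.star_apply,
        RCLike.star_def]
    | algebraMap r =>
      rw [← algebraMap_star_comm]
      exact Subalgebra.algebraMap_mem _ _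
    | add x y _ _ hx hy => rw [star_add]; exact Subalgebra.add_mem _ hx hy
    | mul x y _ _ hx hy => rw [star_mul]; exact Subalgebra.mul_mem _ hy hx

/-- A finite measure on `Hom(G, 𝕋^ℕ)` is determined by its Fourier coefficients. -/
theorem hom_measure_ext [Countable G] {μ ν : Measure (G →ₜ+ InfTorus)} [IsFiniteMeasure μ]
    [IsFiniteMeasure ν]
    (h : ∀ g : ℕ →₀ G, ∫ x, (circleChar g x : ℂ) ∂μ = ∫ x, (circleChar g x : ℂ) ∂ν) : μ = ν := by
  refine ext_of_forall_mem_subalgebra_integral_eq_of_polish (𝕜 := ℂ) (A := homCharAlgebra G) ?_ ?_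
  · intro x y hxy
    obtain ⟨a, ha⟩ : ∃ a, x a ≠ y a := by
      by_contra! H
      exact hxy (ContinuousAddMonoidHom.ext H)
    obtain ⟨i, hi⟩ := Function.ne_iff.mp ha
    refine ⟨homChar (Finsupp.single i a), ⟨_, ⟨homChar (Finsupp.single i a),
      Algebra.subset_adjoin ⟨_, rfl⟩, rfl⟩, rfl⟩, ?_⟩
    simpa [homChar_apply, Circle.ext_iff] using (AddCircle.injective_toCircle one_ne_zero).ne hi
  · intro f hf
    -- Characters are closed under products, so the algebra they generate is their linear span and
    -- linearity of the integral suffices.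
    have hf' : f ∈ Submodule.span ℂ (homCharSubmonoid G : Set ((G →ₜ+ InfTorus) →ᵇ ℂ)) := by
      rw [← (homCharSubmonoid G).closure_eq, ← Algebra.adjoin_eq_span]
      exact hf
    clear hf
    induction hf' using Submodule.span_induction with
    | mem x hx => obtain ⟨g, rfl⟩ := hx; exact h g
    | zero => simp
    | add x y _ _ hx hy =>
      simp only [BoundedContinuousFunction.coe_add, Pi.add_apply]
      rw [integral_add (x.integrable μ) (y.integrable μ), integral_add (x.integrable ν)
        (y.integrable ν), hx, hy]
    | smul c x _ hx =>
      simp only [BoundedContinuousFunction.coe_smul, integral_smul, hx]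

end Characters
open ProbabilityTheory

/-! ### Invariant measures: independence and idempotent coefficients. -/

section InvariantMeasures

variable {G : Type*} [AddGroup G] [TopologicalSpace G]

lemma measurable_coe_circleChar (g : ℕ →₀ G) :
    Measurable fun h : G →ₜ+ InfTorus => (circleChar g h : ℂ) :=
  (continuous_subtype_val.comp (continuous_circleChar g)).measurable

lemma integrable_circleChar (μ : Measure (G →ₜ+ InfTorus)) [IsFiniteMeasure μ]
    (g : ℕ →₀ G) : Integrable (fun h => (circleChar g h : ℂ)) μ :=
  Integrable.of_bound
    (measurable_coe_circleChar g).aestronglyMeasurable 1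
    (Filter.Eventually.of_forall fun h => (Circle.norm_coe (circleChar g h)).le)

lemma ae_circleChar_eq_one {μ : Measure (G →ₜ+ InfTorus)} [IsProbabilityMeasure μ]
    {g : ℕ →₀ G} (h : ∫ x, (circleChar g x : ℂ) ∂μ = 1) : ∀ᵐ x ∂μ, circleChar g x = 1 := by
  have hint := integrable_circleChar μ g
  have hle (x : G →ₜ+ InfTorus) : (circleChar g x : ℂ).re ≤ 1 :=
    (Complex.re_le_norm _).trans (Circle.norm_coe (circleChar g x)).le
  have hintre : Integrable (fun x => (circleChar g x : ℂ).re) μ := hint.re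
  -- Equality case of `Re z ≤ 1` on the unit circle: a nonnegative function with integral zero
  -- vanishes almost everywhere.
  have hre : ∫ x, (1 - (circleChar g x : ℂ).re) ∂μ = 0 := by
    rw [integral_sub (integrable_const _) hintre]
    have : ∫ x, (circleChar g x : ℂ).re ∂μ = (∫ x, (circleChar g x : ℂ) ∂μ).re :=
      integral_re hint
    simp [this, h]
  rw [integral_eq_zero_iff_of_nonneg (fun x => sub_nonneg.mpr (hle x))
    ((integrable_const _).sub hintre)] at hre
  filter_upwards [hre] with x hx
  have hx : (circleChar g x : ℂ).re = 1 := by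
    simp only [Pi.zero_apply] at hx
    linarith
  have hn : (circleChar g x : ℂ).re ^ 2 + (circleChar g x : ℂ).im ^ 2 = 1 := by
    have := Circle.normSq_coe (circleChar g x)
    rw [Complex.normSq_apply] at this
    linarith
  refine Circle.ext (Complex.ext (by simpa using hx) ?_)
  rw [hx] at hn
  simpa using hn

variable {χ : Measure (G →ₜ+ InfTorus)}

namespace IsAutInvariantProb

lemma measurePreserving (hχ : IsAutInvariantProb χ) (ψ : InfTorus ≃ₜ+ InfTorus) :
    MeasurePreserving (autAct ψ) χ χ :=
  ⟨(continuous_autAct ψ).measurable, hχ.map_eq ψ⟩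

lemma integral_circleChar_autAct (hχ : IsAutInvariantProb χ) (ψ : InfTorus ≃ₜ+ InfTorus)
    (g : ℕ →₀ G) :
    ∫ h, (circleChar g (autAct ψ h) : ℂ) ∂χ = ∫ h, (circleChar g h : ℂ) ∂χ := by
  conv_rhs => rw [← hχ.map_eq ψ]
  exact (integral_map (continuous_autAct ψ).aemeasurable
    (measurable_coe_circleChar g).aestronglyMeasurable).symm

/-- The distribution of any subsequence of coordinates is the original one. -/
lemma map_reindex [DiscreteTopology G] [Countable G] (hχ : IsAutInvariantProb χ) {ι : ℕ → ℕ}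
    (hι : ι.Injective) : χ.map (fun h => (reindexHom ι).comp h) = χ := by
  have := hχ.isProbabilityMeasure
  refine hom_measure_ext fun g => ?_
  rw [integral_map (continuous_hom_comp_left _).aemeasurable
    (measurable_coe_circleChar g).aestronglyMeasurable]
  obtain ⟨σ, hσ⟩ := exists_perm_eqOn_finset hι g.support
  rw [← hχ.integral_circleChar_autAct (permAut σ)]
  congr 1 with h
  congr 1
  refine Finset.prod_congr rfl fun i hi => ?_
  exact congrArg (fun n => AddCircle.toCircle (h (g i) n)) (hσ i hi).symm

/-- Conditioning on an event of the odd coordinates leaves the law of the even coordinates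
invariant. -/
lemma map_evenPart_cond (hχ : IsAutInvariantProb χ) {C : Set (G →ₜ+ InfTorus)}
    (hC : MeasurableSet C) (hC0 : χ ((fun h => oddPart.comp h) ⁻¹' C) ≠ 0) :
    IsAutInvariantProb
      ((χ[|(fun h => oddPart.comp h) ⁻¹' C]).map fun h => evenPart.comp h) := by
  have := hχ.isProbabilityMeasure
  have he : Measurable fun h : G →ₜ+ InfTorus => evenPart.comp h :=
    (continuous_hom_comp_left _).measurable
  have ho : Measurable fun h : G →ₜ+ InfTorus => oddPart.comp h :=
    (continuous_hom_comp_left _).measurable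
  refine ⟨?_, fun ψ => ?_⟩
  · have := cond_isProbabilityMeasure hC0
    exact Measure.isProbabilityMeasure_map he.aemeasurable
  · have hψ : Measurable (autAct (G := G) ψ) := (continuous_autAct ψ).measurable
    ext B hB
    rw [Measure.map_apply hψ hB, Measure.map_apply he (hψ hB), Measure.map_apply he hB,
      cond_apply (ho hC), cond_apply (ho hC),
      ← (hχ.measurePreserving (evenAut ψ)).measure_preimage
        ((ho hC).inter (he hB)).nullMeasurableSet]
    -- `evenAut ψ` fixes the odd half, hence the conditioning event, and acts by `ψ` on the even
    -- half.
    congr 2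
    ext h
    have h1 : evenPart.comp (autAct (evenAut ψ) h) = autAct ψ (evenPart.comp h) :=
      ContinuousAddMonoidHom.ext fun a => evenPart_interleave _ _
    have h2 : oddPart.comp (autAct (evenAut ψ) h) = oddPart.comp h :=
      ContinuousAddMonoidHom.ext fun a => oddPart_interleave _ _
    simp only [Set.mem_inter_iff, Set.mem_preimage, h1, h2]

/-- For an indecomposable invariant measure the even coordinates are independent of the odd
ones. -/
lemma indepFun_evenPart_oddPart [DiscreteTopology G] [Countable G] (hχ : IsAutInvariantProb χ)
    (hχ' : IsIndecomposable χ) :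
    IndepFun (fun h : G →ₜ+ InfTorus => evenPart.comp h) (fun h => oddPart.comp h) χ := by
  have := hχ.isProbabilityMeasure
  have he : Measurable fun h : G →ₜ+ InfTorus => evenPart.comp h :=
    (continuous_hom_comp_left _).measurable
  have ho : Measurable fun h : G →ₜ+ InfTorus => oddPart.comp h :=
    (continuous_hom_comp_left _).measurable
  rw [indepFun_iff_measure_inter_preimage_eq_mul]
  intro B C hB hC
  set D := (fun h : G →ₜ+ InfTorus => oddPart.comp h) ⁻¹' C with hD
  have hDm : MeasurableSet D := ho hC
  -- Null and conull events are split off because the weights of a decomposition must lie strictly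
  -- between 0 and 1.
  by_cases h0 : χ D = 0
  · rw [h0, mul_zero]
    exact measure_mono_null Set.inter_subset_right h0
  by_cases h1 : χ Dᶜ = 0
  · rw [(prob_compl_eq_zero_iff hDm).mp h1, mul_one, measure_inter_conull h1]
  have hmap : χ.map (fun h => evenPart.comp h) = χ :=
    hχ.map_reindex (mul_right_injective₀ two_ne_zero)
  set χ₁ := (χ[|D]).map fun h => evenPart.comp h with hχ₁
  set χ₂ := (χ[|Dᶜ]).map fun h => evenPart.comp h with hχ₂
  have hsum : χ = χ D • χ₁ + χ Dᶜ • χ₂ := by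
    conv_lhs => rw [← hmap]
    ext E hE
    simp only [Measure.add_apply, Measure.smul_apply, smul_eq_mul, hχ₁, hχ₂,
      Measure.map_apply he hE]
    rw [mul_comm, mul_comm (χ Dᶜ), cond_mul_eq_inter hDm, cond_mul_eq_inter hDm.compl,
      Set.inter_comm, Set.inter_comm Dᶜ, ← Set.sdiff_eq, measure_inter_add_sdiff _ hDm]
  have heq : χ₁ = χ₂ := by
    by_contra hne
    refine hχ' ⟨χ.real D, χ₁, χ₂, ?_, ?_, hχ.map_evenPart_cond hC h0,
      hχ.map_evenPart_cond hC.compl h1, hne, ?_⟩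
    · exact ENNReal.toReal_pos h0 (measure_ne_top _ _)
    · have := ENNReal.toReal_pos h1 (measure_ne_top _ _)
      have h2 := probReal_compl_eq_one_sub (μ := χ) hDm
      rw [measureReal_def] at h2
      linarith
    · rw [← probReal_compl_eq_one_sub hDm, ofReal_measureReal, ofReal_measureReal]
      exact hsum
  -- Equal conditional laws must both be their average `χ`, so conditioning on `D` has no effect on
  -- the even half.
  have hχ₁χ : χ₁ = χ := by
    rw [← heq, ← add_smul, measure_add_measure_compl hDm, measure_univ, one_smul] at hsum
    exact hsum.symm
  have hB' : χ₁ B = χ ((fun h => evenPart.comp h) ⁻¹' B) := by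
    rw [hχ₁χ, ← Measure.map_apply he hB, hmap]
  rw [← hB', hχ₁, Measure.map_apply he hB, cond_mul_eq_inter hDm, Set.inter_comm]

/-- The Fourier coefficients of an indecomposable invariant measure are idempotent. -/
lemma integral_circleChar_mul_self [DiscreteTopology G] [Countable G]
    (hχ : IsAutInvariantProb χ) (hχ' : IsIndecomposable χ) (g : ℕ →₀ G) :
    (∫ h, (circleChar g h : ℂ) ∂χ) * ∫ h, (circleChar g h : ℂ) ∂χ =
      ∫ h, (circleChar g h : ℂ) ∂χ := by
  have hmeas := measurable_coe_circleChar g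
  have hre {ι : ℕ → ℕ} (hι : ι.Injective) :
      ∫ h, (circleChar g ((reindexHom ι).comp h) : ℂ) ∂χ = ∫ h, (circleChar g h : ℂ) ∂χ := by
    conv_rhs => rw [← hχ.map_reindex hι]
    exact (integral_map (continuous_hom_comp_left _).aemeasurable
      hmeas.aestronglyMeasurable).symm
  have heven : (fun n => 2 * n : ℕ → ℕ).Injective := mul_right_injective₀ two_ne_zero
  have hodd : (fun n => 2 * n + 1 : ℕ → ℕ).Injective := fun a b h => by
    simp only at h
    omega
  have hind := (hχ.indepFun_evenPart_oddPart hχ').comp hmeas hmeas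
  have hprod := hind.integral_fun_mul_eq_mul_integral
    (hmeas.comp (continuous_hom_comp_left _).measurable).aestronglyMeasurable
    (hmeas.comp (continuous_hom_comp_left _).measurable).aestronglyMeasurable
  -- The sheared even half is the sum of two independent copies, so its coefficient is a square; by
  -- invariance it is also the original coefficient.
  have hshear (h : G →ₜ+ InfTorus) :
      evenPart.comp (autAct shearAut h) = evenPart.comp h + oddPart.comp h :=
    ContinuousAddMonoidHom.ext fun a => evenPart_interleave _ _
  calc (∫ h, (circleChar g h : ℂ) ∂χ) * ∫ h, (circleChar g h : ℂ) ∂χ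
      = (∫ h, (circleChar g (evenPart.comp h) : ℂ) ∂χ) *
          ∫ h, (circleChar g (oddPart.comp h) : ℂ) ∂χ := by
        rw [evenPart, oddPart, hre heven, hre hodd]
    _ = ∫ h, (circleChar g (evenPart.comp h) : ℂ) * (circleChar g (oddPart.comp h) : ℂ) ∂χ :=
        hprod.symm
    _ = ∫ h, (circleChar g (evenPart.comp (autAct shearAut h)) : ℂ) ∂χ := by
        simp only [hshear, circleChar_add_right, Circle.coe_mul]
    _ = ∫ h, (circleChar g (evenPart.comp h) : ℂ) ∂χ := by
        conv_rhs => rw [← hχ.map_eq shearAut]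
        exact (integral_map (continuous_autAct _).aemeasurable
          (hmeas.comp (continuous_hom_comp_left _).measurable).aestronglyMeasurable).symm
    _ = ∫ h, (circleChar g h : ℂ) ∂χ := hre heven

lemma circleChar_autAct_transvectionAut {g : ℕ →₀ G} {i j : ℕ} (hij : i ≠ j)
    (h : G →ₜ+ InfTorus) :
    circleChar g (autAct (transvectionAut hij) h) =
      circleChar g h * AddCircle.toCircle (h (g i) j) := by
  have hsingle : (∏ k ∈ g.support,
      AddCircle.toCircle ((Pi.single i (h (g k) j) : InfTorus) k)) =
        AddCircle.toCircle (h (g i) j) := by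
    rw [Finset.prod_eq_single i]
    · simp
    · intro k _ hk
      simp [hk]
    · intro hi
      simp [Finsupp.notMem_support_iff.mp hi]
  rw [← hsingle, circleChar, circleChar, Finsupp.prod, Finsupp.prod, ← Finset.prod_mul_distrib]
  exact Finset.prod_congr rfl fun k _ => AddCircle.toCircle_add _ _

/-- A character that is trivial almost everywhere only involves elements of the group that are
killed by almost every homomorphism. -/
lemma ae_apply_eq_zero (hχ : IsAutInvariantProb χ) {g : ℕ →₀ G}
    (hg : ∀ᵐ h ∂χ, circleChar g h = 1) (i : ℕ) : ∀ᵐ h ∂χ, h (g i) = 0 := by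
  obtain ⟨j, hj⟩ := Infinite.exists_notMem_finset (insert i g.support)
  have hij : i ≠ j := by
    rintro rfl
    simp at hj
  have hcoord : ∀ᵐ h ∂χ, h (g i) j = 0 := by
    -- The character is 1 both at `h` and at its transvected image; the quotient of the two values
    -- isolates the `j`-th coordinate of `h (g i)`.
    filter_upwards [hg, (hχ.measurePreserving (transvectionAut hij)).quasiMeasurePreserving.ae hg]
      with h h1 h2
    rw [circleChar_autAct_transvectionAut, h1, one_mul, toCircle_eq_one_iff] at h2
    exact h2
  -- Invariance under coordinate swaps carries the vanishing from coordinate `j` to every `k`.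
  have hall : ∀ k, ∀ᵐ h ∂χ, h (g i) k = 0 := fun k => by
    filter_upwards [(hχ.measurePreserving
      (permAut (Equiv.swap j k))).quasiMeasurePreserving.ae hcoord] with h hh
    simpa [autAct, permAut] using hh
  filter_upwards [ae_all_iff.mpr hall] with h hh
  exact funext hh

end IsAutInvariantProb

/-- The elements of the group killed by almost every homomorphism. -/
def aeKernel {K : Type*} [AddCommGroup K] [TopologicalSpace K] (μ : Measure (G →ₜ+ K)) :
    AddSubgroup G where
  carrier := {a | ∀ᵐ h ∂μ, h a = 0}
  zero_mem' := by simp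
  add_mem' {a b} ha hb := by
    change ∀ᵐ h ∂μ, h (a + b) = 0
    filter_upwards [ha, hb] with h h1 h2
    rw [map_add, h1, h2, add_zero]
  neg_mem' {a} ha := by
    change ∀ᵐ h ∂μ, h (-a) = 0
    filter_upwards [ha] with h h1
    rw [map_neg, h1, neg_zero]

instance aeKernel_normal {K : Type*} [AddCommGroup K] [TopologicalSpace K]
    (μ : Measure (G →ₜ+ K)) : (aeKernel μ).Normal where
  conj_mem a ha b := by
    change ∀ᵐ h ∂μ, h (b + a + -b) = 0
    filter_upwards [ha] with h h1
    simp [h1]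

end InvariantMeasures

/-! ### Fourier coefficients of Haar measure on `Hom(G/H, 𝕋^ℕ)`. -/

section QuotientHaar

variable {G : Type*} [AddGroup G] [TopologicalSpace G] [DiscreteTopology G]

lemma isProbabilityMeasure_homQuotientHaar (H : AddSubgroup G) [H.Normal] :
    IsProbabilityMeasure (homQuotientHaar InfTorus H) := by
  have : IsProbabilityMeasure (Measure.addHaarMeasure
      (⊤ : TopologicalSpace.PositiveCompacts ((G ⧸ H) →ₜ+ InfTorus))) :=
    ⟨Measure.addHaarMeasure_self⟩
  exact Measure.isProbabilityMeasure_map (continuous_homQuotientEmbedding _ H).aemeasurable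

lemma integral_circleChar_homQuotientHaar (H : AddSubgroup G) [H.Normal] (g : ℕ →₀ G) :
    ∫ h, (circleChar g h : ℂ) ∂(homQuotientHaar InfTorus H) =
      ∫ φ, (circleChar g (homQuotientEmbedding InfTorus H φ) : ℂ) ∂(Measure.addHaarMeasure
        (⊤ : TopologicalSpace.PositiveCompacts ((G ⧸ H) →ₜ+ InfTorus))) :=
  integral_map (continuous_homQuotientEmbedding _ H).aemeasurable
    (measurable_coe_circleChar g).aestronglyMeasurable

lemma integral_circleChar_homQuotientHaar_eq_one {H : AddSubgroup G} [H.Normal] {g : ℕ →₀ G}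
    (hg : ∀ i, g i ∈ H) : ∫ h, (circleChar g h : ℂ) ∂(homQuotientHaar InfTorus H) = 1 := by
  have hone (φ : (G ⧸ H) →ₜ+ InfTorus) :
      circleChar g (homQuotientEmbedding InfTorus H φ) = 1 := by
    refine Finset.prod_eq_one fun i _ => ?_
    have : homQuotientEmbedding InfTorus H φ (g i) = 0 := by
      change φ (QuotientAddGroup.mk (g i)) = 0
      rw [(QuotientAddGroup.eq_zero_iff _).mpr (hg i), map_zero]
    simp [this]
  have := isProbabilityMeasure_homQuotientHaar H
  have : IsProbabilityMeasure (Measure.addHaarMeasure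
      (⊤ : TopologicalSpace.PositiveCompacts ((G ⧸ H) →ₜ+ InfTorus))) :=
    ⟨Measure.addHaarMeasure_self⟩
  simp [integral_circleChar_homQuotientHaar, hone]

lemma integral_circleChar_homQuotientHaar_eq_zero {H : AddSubgroup G} [H.Normal] {g : ℕ →₀ G}
    {h₀ : G →ₜ+ InfTorus} (hH : ∀ a ∈ H, h₀ a = 0) {i : ℕ} (hi : h₀ (g i) ≠ 0) :
    ∫ h, (circleChar g h : ℂ) ∂(homQuotientHaar InfTorus H) = 0 := by
  obtain ⟨j, hj⟩ := Function.ne_iff.mp hi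
  -- The `j`-th coordinate of `h₀`, moved to slot `i` with zeros elsewhere, so that the character
  -- only sees its value at `g i`. It descends to the quotient since `h₀` kills `H`.
  let ψ : (G ⧸ H) →ₜ+ InfTorus :=
    { toAddMonoidHom := QuotientAddGroup.lift H
        (((AddMonoidHom.single (fun _ : ℕ => UnitAddCircle) i).comp
          (Pi.evalAddMonoidHom (fun _ : ℕ => UnitAddCircle) j)).comp h₀.toAddMonoidHom)
        fun a ha => by
          have : h₀ a j = 0 := congrFun (hH a ha) j
          simp [this]
      continuous_toFun := continuous_of_discreteTopology }
  have hψ : circleChar g (homQuotientEmbedding InfTorus H ψ) =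
      AddCircle.toCircle (h₀ (g i) j) := by
    have hval (a : G) (k : ℕ) :
        homQuotientEmbedding InfTorus H ψ a k = (Pi.single i (h₀ a j) : InfTorus) k := rfl
    simp only [circleChar, hval, Finsupp.prod]
    rw [Finset.prod_eq_single i]
    · simp
    · intro k _ hk
      simp [hk]
    · intro hi
      simp [Finsupp.notMem_support_iff.mp hi]
  have hne : circleChar g (homQuotientEmbedding InfTorus H ψ) ≠ 1 := by
    rw [hψ, Ne, toCircle_eq_one_iff]
    exact hj
  rw [integral_circleChar_homQuotientHaar]
  set m := Measure.addHaarMeasure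
    (⊤ : TopologicalSpace.PositiveCompacts ((G ⧸ H) →ₜ+ InfTorus))
  have hadd (φ : (G ⧸ H) →ₜ+ InfTorus) : homQuotientEmbedding InfTorus H (ψ + φ) =
      homQuotientEmbedding InfTorus H ψ + homQuotientEmbedding InfTorus H φ := rfl
  -- Translation by `ψ` multiplies the integral by a constant other than 1, yet preserves it.
  have htrans := integral_add_left_eq_self (μ := m)
    (fun φ => (circleChar g (homQuotientEmbedding InfTorus H φ) : ℂ)) ψ
  simp only [hadd, circleChar_add_right, Circle.coe_mul] at htrans
  rw [integral_const_mul] at htrans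
  by_contra h0
  exact hne (Circle.ext (by simpa using mul_right_cancel₀ h0 (htrans.trans (one_mul _).symm)))

end QuotientHaar

/-! ### Comparison of the two families of coefficients. -/

theorem mainTheorem5 {G : Type*} [AddGroup G] [Countable G] [TopologicalSpace G]
    [DiscreteTopology G] (χ : Measure (G →ₜ+ InfTorus)) (hχ : IsAutInvariantProb χ)
    (hχ' : IsIndecomposable χ) :
    ∃ (H : AddSubgroup G) (_ : H.Normal), χ = homQuotientHaar InfTorus H := by
  have := hχ.isProbabilityMeasure
  have := isProbabilityMeasure_homQuotientHaar (aeKernel χ)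
  refine ⟨aeKernel χ, inferInstance, hom_measure_ext fun g => ?_⟩
  by_cases hg : ∀ i, g i ∈ aeKernel χ
  · rw [integral_circleChar_homQuotientHaar_eq_one hg]
    have hone : ∀ᵐ h ∂χ, (circleChar g h : ℂ) = 1 := by
      filter_upwards [ae_all_iff.mpr hg] with h hh
      simp [circleChar, Finsupp.prod, hh]
    simp [integral_congr_ae hone]
  · obtain ⟨i, hi⟩ := not_forall.mp hg
    have hfreq : ∃ᵐ h ∂χ, h (g i) ≠ 0 := by
      rw [Filter.Frequently]
      simp only [not_not]
      exact hi
    -- As `G` is countable, almost every homomorphism kills the whole kernel at once; one of these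
    -- is nonzero at `g i`.
    have hker : ∀ᵐ h ∂χ, ∀ a : aeKernel χ, h a = 0 := ae_all_iff.mpr fun a => a.2
    obtain ⟨h₀, h₀i, h₀H⟩ := (hfreq.and_eventually hker).exists
    rw [integral_circleChar_homQuotientHaar_eq_zero (fun a ha => h₀H ⟨a, ha⟩) h₀i]
    rcases IsIdempotentElem.iff_eq_zero_or_one.mp (hχ.integral_circleChar_mul_self hχ' g) with h | h
    · exact h
    · exact absurd (hχ.ae_apply_eq_zero (ae_circleChar_eq_one h) i) hi
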